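/- Let $S$ be a compact connected Riemann surface, and let $Y\subset S$ be a connected bordered Riemann surface with $\mathcal{C}^2$-smooth boundary, that is, $Y=S\setminus(D_1\sqcup\dots\sqcup D_m)$, $m\ge 1$, is connected, where $D_1,\dots,D_m\subset S$ are pairwise disjoint closed topological disks whose boundaries are $\mathcal{C}^2$-smooth. For $n\ge 1$ let $\mathrm{Sym}^n(S)=S^n/S_n$ be the $n$-fold symmetric product, the space of unordered $n$-tuples $\langle x_1,\dots,x_n\rangle$ of points of $S$, with the quotient topology and with the complex structure given locally by the elementary symmetric polynomials in $\varphi(x_1),\dots,\varphi(x_n)$, where $\varphi$ is a (not necessarily connected) holomorphic chart of $S$ whose domain contains $x_1,\dots,x_n$. Let $Z$ be a connected complex manifold, and let $f:Z\to \mathrm{Sym}^n(S)$ be a holomorphic map with $f(Z)\subset\overline{\mathrm{Sym}^n(Y)}$, the closure being taken in $\mathrm{Sym}^n(S)$. Suppose that there are $z_0\in Z$ and $y_1\in\partial Y$ such that $f(z_0)$ is of the form $\langle y_1,*\rangle$, i.e. $y_1$ is one of the entries of $f(z_0)$. Then $f(z)$ is of the form $\langle y_1,*\rangle$ for all $z\in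 Z$. Moreover, if $y_1$ appears exactly $k$ times, $1\le k\le n$, among the entries of $f(z_0)$, then $y_1$ appears exactly $k$ times among the entries of $f(z)$ for every $z\in Z$. -/

import Mathlib

open scoped Manifold ContDiff Topology

noncomputable section

namespace SymProd

/-- The quotient map `(x₁, …, xₙ) ↦ ⟨x₁, …, xₙ⟩` from `Xⁿ` to the `n`-fold symmetric product,
the latter being Mathlib's type `Sym X n` of unordered `n`-tuples with repetition. -/
def proj {X : Type*} {n : ℕ} (v : Fin n → X) : Sym X n :=
  ⟨Finset.univ.val.map v, by simp⟩

/-- The symmetric product carries the quotient topology relative to `proj`. -/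
instance instTopologicalSpace {X : Type*} [TopologicalSpace X] {n : ℕ} :
    TopologicalSpace (Sym X n) :=
  TopologicalSpace.coinduced (proj (X := X) (n := n)) inferInstance

/-- `Symⁿ(U)` as a subset of `Symⁿ(X)`, for `U ⊆ X`. -/
def symSet {X : Type*} (n : ℕ) (U : Set X) : Set (Sym X n) :=
  {s | ∀ x ∈ s, x ∈ U}

/-- The elementary symmetric coordinates
`⟨x₁, …, xₙ⟩ ↦ (σ₁(φ x₁, …, φ xₙ), …, σₙ(φ x₁, …, φ xₙ))` given by a function `φ`. -/
def esymmCoord {X : Type*} {n : ℕ} (φ : X → ℂ) (s : Sym X n) : Fin n → ℂ :=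
  fun i => ((s : Multiset X).map φ).esymm (i + 1)

/-- Holomorphic maps from a complex manifold `Z` into the complex manifold `Symⁿ(X)`, for a
Riemann surface `X`: continuous maps that are holomorphic in all model coordinate charts
of `Symⁿ(X)`.
A model chart comes from a holomorphic chart `φ` of `X` with domain `U` (a member of the maximal
holomorphic atlas of `X`); it is the map `esymmCoord φ` on the open set `Symⁿ(U)`. The set `U` need
not be connected: if `φ₁, …, φₗ` are charts of `X` around distinct points, with pairwise disjoint
domains and pairwise disjoint images, then they form together one chart `φ`. Hence the
sets `Symⁿ(U)` cover `Symⁿ(X)`. (Complex `C¹` is the same as holomorphic.) -/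
structure IsHolomorphic {E : Type*} [NormedAddCommGroup E] [NormedSpace ℂ E]
    {Z : Type*} [TopologicalSpace Z] [ChartedSpace E Z]
    {X : Type*} [TopologicalSpace X] [ChartedSpace ℂ X] {n : ℕ} (f : Z → Sym X n) : Prop where
  continuous : Continuous f
  mdifferentiableOn : ∀ φ ∈ IsManifold.maximalAtlas 𝓘(ℂ) 1 X,
    MDifferentiableOn 𝓘(ℂ, E) 𝓘(ℂ, Fin n → ℂ) (fun z => esymmCoord φ (f z))
      (f ⁻¹' symSet n φ.source)

end SymProd

/-- `D` is a closed topological disk in the Riemann surface `S` whose boundary is `C²`-smooth: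
near each of its boundary points `p`, in the local coordinate at `p`, the set `D` is a sublevel
set `{ρ ≤ 0}` of a real-valued `C²` function `ρ` with nonvanishing (real) differential at `p`. -/
structure IsC2ClosedDisk {S : Type*} [TopologicalSpace S] [ChartedSpace ℂ S] (D : Set S) :
    Prop where
  isClosed : IsClosed D
  homeo : Nonempty (D ≃ₜ Metric.closedBall (0 : ℂ) 1)
  smooth : ∀ p ∈ frontier D, ∃ ρ : ℂ → ℝ,
    ContDiffAt ℝ 2 ρ (chartAt ℂ p p) ∧ fderiv ℝ ρ (chartAt ℂ p p) ≠ 0 ∧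
      ∀ᶠ x in 𝓝 p, (x ∈ D ↔ ρ (chartAt ℂ p x) ≤ 0)

/-- `Y` is a connected bordered Riemann surface with `C²`-smooth boundary in the compact Riemann
surface `S`: it is connected and obtained from `S` by excising finitely many (at least one)
pairwise disjoint closed disks with `C²`-smooth boundary. -/
def IsC2Bordered {S : Type*} [TopologicalSpace S] [ChartedSpace ℂ S] (Y : Set S) : Prop :=
  IsConnected Y ∧ ∃ (m : ℕ) (D : Fin m → Set S), 0 < m ∧ (∀ j, IsC2ClosedDisk (D j)) ∧
    (∀ i j, i ≠ j → Disjoint (D i) (D j)) ∧ Y = (⋃ j, D j)ᶜ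

end

/-! At `y₁` the `C²` boundary has a tangent disk on the side away from `Y`. A Möbius map that takes
the exterior of this disk into the unit disk gives a chart `φ` with `φ y₁ = 1` and `‖φ‖ < 1` at all
other nearby points of `closure Y` (`IsC2Bordered.exists_peak_chart`). Small charts around the other
entries of `f z`, with values inside the unit disk, are glued to it
(`IsManifold.exists_mem_maximalAtlas_finset_subset`). The power sums `∑ φ(xᵢ)^N` of the entries of
`f` are then holomorphic, bounded by `n`, and converge pointwise to the multiplicity of `y₁` as `N →
∞`. The Schwarz lemma gives them a common Lipschitz constant, so the integer-valued limit is locally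
constant (`SymProd.IsHolomorphic.eventually_count_eq`), hence constant on the connected `Z`. -/

namespace SymProd

/-! ### Symmetric products and their coordinates -/

theorem mem_proj {X : Type*} {n : ℕ} {v : Fin n → X} {x : X} : x ∈ proj v ↔ ∃ i, v i = x := by
  change x ∈ Finset.univ.val.map v ↔ _
  simp

theorem proj_surjective {X : Type*} {n : ℕ} : Function.Surjective (proj (X := X) (n := n)) := by
  rintro ⟨m, hm⟩
  induction m using Quotient.inductionOn with
  | h l =>
    obtain rfl : l.length = n := hm
    exact ⟨l.get, Subtype.ext (by simp [proj, Fin.univ_val_map])⟩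

theorem preimage_proj_symSet {X : Type*} {n : ℕ} (U : Set X) :
    proj (n := n) ⁻¹' symSet n U = Set.univ.pi fun _ => U := by
  ext v
  simp [symSet, mem_proj, Set.mem_pi]

theorem isOpen_symSet {X : Type*} [TopologicalSpace X] {n : ℕ} {U : Set X} (hU : IsOpen U) :
    IsOpen (symSet n U) := by
  rw [isOpen_coinduced, preimage_proj_symSet]
  exact isOpen_set_pi Set.finite_univ fun _ _ => hU

theorem isClosed_symSet {X : Type*} [TopologicalSpace X] {n : ℕ} {U : Set X} (hU : IsClosed U) :
    IsClosed (symSet n U) := by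
  rw [isClosed_coinduced, preimage_proj_symSet]
  exact isClosed_set_pi fun _ _ => hU

theorem closure_symSet_subset {X : Type*} [TopologicalSpace X] {n : ℕ} (U : Set X) :
    closure (symSet n U) ⊆ symSet n (closure U) :=
  closure_minimal (fun _ hs x hx => subset_closure (hs x hx)) (isClosed_symSet isClosed_closure)

/-- Power sums are polynomials in the elementary symmetric coordinates. -/
theorem exists_powerSum_eq_eval (n N : ℕ) : ∃ q : MvPolynomial (Fin n) ℂ,
    ∀ {X : Type*} (φ : X → ℂ) (s : Sym X n),
      ((s : Multiset X).map fun x => φ x ^ N).sum = MvPolynomial.eval (esymmCoord φ s) q := by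
  obtain ⟨q, hq⟩ := MvPolynomial.esymmAlgHom_surjective (σ := Fin n) (n := n) ℂ (by simp)
    ⟨MvPolynomial.psum (Fin n) ℂ N, MvPolynomial.psum_isSymmetric _ _ _⟩
  refine ⟨q, fun φ s => ?_⟩
  obtain ⟨v, rfl⟩ := proj_surjective s
  have h : MvPolynomial.aeval (fun i : Fin n => MvPolynomial.aeval (φ ∘ v)
      (MvPolynomial.esymm (Fin n) ℂ (i + 1))) q
      = MvPolynomial.aeval (φ ∘ v) (MvPolynomial.psum (Fin n) ℂ N) := by
    rw [← MvPolynomial.comp_aeval_apply, ← MvPolynomial.esymmAlgHom_apply, hq]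
  have hc : (fun i : Fin n => MvPolynomial.aeval (φ ∘ v) (MvPolynomial.esymm (Fin n) ℂ (i + 1)))
      = esymmCoord φ (proj v) := by
    ext i
    rw [MvPolynomial.aeval_esymm_eq_multiset_esymm]
    simp [esymmCoord, proj, Function.comp_def]
  rw [hc, MvPolynomial.aeval_eq_eval] at h
  refine Eq.trans ?_ h.symm
  simp [MvPolynomial.psum, proj, List.sum_ofFn]

end SymProd

/-! ### Power sums and local constancy of the multiplicity -/

theorem Multiset.norm_sum_map_pow_le {X : Type*} {φ : X → ℂ} {m : Multiset X}
    (h : ∀ x ∈ m, ‖φ x‖ ≤ 1) (N : ℕ) : ‖(m.map fun x => φ x ^ N).sum‖ ≤ m.card := by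
  induction m using Multiset.induction_on with
  | empty => simp
  | cons a s ih =>
    rw [Multiset.map_cons, Multiset.sum_cons, Multiset.card_cons, Nat.cast_succ, add_comm]
    refine (norm_add_le _ _).trans (add_le_add (ih fun x hx => h x (by simp [hx])) ?_)
    rw [norm_pow]
    exact pow_le_one₀ (norm_nonneg _) (h a (by simp))

/-- Powers of a number inside the unit disk tend to `0`, so only the copies of `y`, each
contributing `1`, survive. -/
theorem Multiset.tendsto_sum_map_pow {X : Type*} [DecidableEq X] {φ : X → ℂ} {m : Multiset X}
    {y : X} (hy : φ y = 1) (h : ∀ x ∈ m, x ≠ y → ‖φ x‖ < 1) :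
    Filter.Tendsto (fun N : ℕ => (m.map fun x => φ x ^ N).sum) Filter.atTop
      (𝓝 (m.count y : ℂ)) := by
  induction m using Multiset.induction_on with
  | empty => simp
  | cons a s ih =>
    simp only [Multiset.map_cons, Multiset.sum_cons, Multiset.count_cons, Nat.cast_add]
    rw [add_comm]
    refine Filter.Tendsto.add ?_ (ih fun x hx => h x (by simp [hx]))
    by_cases ha : a = y
    · rw [if_pos ha.symm, Nat.cast_one]
      exact tendsto_const_nhds.congr fun N => by rw [ha, hy, one_pow]
    · simpa [Ne.symm ha] using tendsto_pow_atTop_nhds_zero_of_norm_lt_one (h a (by simp) ha)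

/-- The local form of the statement: if `φ` peaks at `y` among the points of `K`, then the
multiplicity of `y` is locally constant along a holomorphic map into `Symⁿ(K)`. -/
theorem SymProd.IsHolomorphic.eventually_count_eq {S : Type*} [TopologicalSpace S]
    [ChartedSpace ℂ S] [DecidableEq S] {K : Set S}
    {E : Type*} [NormedAddCommGroup E] [NormedSpace ℂ E]
    {Z : Type*} [TopologicalSpace Z] [ChartedSpace E Z] [IsManifold 𝓘(ℂ, E) 1 Z]
    {n : ℕ} {f : Z → Sym S n} (hf : SymProd.IsHolomorphic (E := E) f)
    (hfK : ∀ z, f z ∈ SymProd.symSet n K) {φ : OpenPartialHomeomorph S ℂ}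
    (hφ : φ ∈ IsManifold.maximalAtlas 𝓘(ℂ) 1 S) {y : S} (hy : φ y = 1)
    (hpeak : ∀ x ∈ φ.source ∩ K, x ≠ y → ‖φ x‖ < 1) {z₀ : Z}
    (hz₀ : f z₀ ∈ SymProd.symSet n φ.source) :
    ∀ᶠ z in 𝓝 z₀, (f z : Multiset S).count y = (f z₀ : Multiset S).count y := by
  set W : Set Z := f ⁻¹' SymProd.symSet n φ.source
  have hWo : IsOpen W := (SymProd.isOpen_symSet φ.open_source).preimage hf.continuous
  set e := chartAt E z₀
  obtain ⟨R, hR, hball⟩ : ∃ R > 0, Metric.ball (e z₀) R ⊆ e.target ∩ e.symm ⁻¹' W := by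
    refine Metric.isOpen_iff.1 (e.symm.isOpen_inter_preimage hWo) _ ⟨mem_chart_target E z₀, ?_⟩
    rw [Set.mem_preimage, e.left_inv (mem_chart_source E z₀)]
    exact hz₀
  set h : ℕ → E → ℂ := fun N u => ((f (e.symm u) : Multiset S).map fun x => φ x ^ N).sum
  have hpk : ∀ u ∈ Metric.ball (e z₀) R, ∀ x ∈ f (e.symm u), x ≠ y → ‖φ x‖ < 1 :=
    fun u hu x hx hxy => hpeak x ⟨(hball hu).2 x hx, hfK _ x hx⟩ hxy
  have hbound : ∀ N, ∀ u ∈ Metric.ball (e z₀) R, ‖h N u‖ ≤ n := by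
    intro N u hu
    have := Multiset.norm_sum_map_pow_le (m := (f (e.symm u) : Multiset S)) (φ := φ) (fun x hx => by
      by_cases hxy : x = y
      · simp [hxy, hy]
      · exact (hpk u hu x hx hxy).le) N
    rwa [Sym.card_coe] at this
  have hdiff : ∀ N, DifferentiableOn ℂ (h N) (Metric.ball (e z₀) R) := by
    intro N
    obtain ⟨q, hq⟩ := SymProd.exists_powerSum_eq_eval n N
    have h1 : MDifferentiableOn 𝓘(ℂ, E) 𝓘(ℂ, Fin n → ℂ)
        (fun u => SymProd.esymmCoord φ (f (e.symm u))) (Metric.ball (e z₀) R) :=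
      (hf.mdifferentiableOn φ hφ).comp
        (((contMDiffOn_symm_of_mem_maximalAtlas
          (IsManifold.chart_mem_maximalAtlas (I := 𝓘(ℂ, E)) (n := 1) z₀)).mdifferentiableOn
          one_ne_zero).mono fun u hu => (hball hu).1) fun u hu => (hball hu).2
    have h2 : Differentiable ℂ fun w : Fin n → ℂ => MvPolynomial.eval w q := fun w =>
      (AnalyticOnNhd.eval_mvPolynomial q w trivial).differentiableAt
    refine (h2.comp_differentiableOn h1.differentiableOn).congr fun u _ => ?_
    exact hq φ _
  have hlim : ∀ u ∈ Metric.ball (e z₀) R, Filter.Tendsto (fun N => h N u) Filter.atTop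
      (𝓝 ((f (e.symm u) : Multiset S).count y : ℂ)) := fun u hu =>
    Multiset.tendsto_sum_map_pow hy (hpk u hu)
  have hc : e z₀ ∈ Metric.ball (e z₀) R := Metric.mem_ball_self hR
  -- Schwarz lemma: `h N` maps the ball of radius `R` into a disk of radius `2 * n` about its
  -- central value. The constant does not depend on `N`, so it passes to the limit.
  have hlip : ∀ u ∈ Metric.ball (e z₀) R,
      dist ((f (e.symm u) : Multiset S).count y : ℂ) ((f z₀ : Multiset S).count y : ℂ)
        ≤ 2 * n / R * dist u (e z₀) := by
    intro u hu
    have h0 := hlim _ hc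
    rw [e.left_inv (mem_chart_source E z₀)] at h0
    refine le_of_tendsto ((hlim u hu).dist h0) (Filter.Eventually.of_forall fun N => ?_)
    refine Complex.dist_le_div_mul_dist_of_mapsTo_ball (hdiff N) (fun w hw => ?_) hu
    rw [Metric.mem_closedBall, dist_eq_norm, two_mul]
    exact (norm_sub_le _ _).trans (add_le_add (hbound N w hw) (hbound N _ hc))
  have hsmall : ∀ᶠ u in 𝓝 (e z₀), 2 * n / R * dist u (e z₀) < 1 := by
    have : Continuous fun u => 2 * n / R * dist u (e z₀) := by fun_prop
    exact this.continuousAt.eventually_lt continuousAt_const (by simp)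
  have hes := e.continuousAt (mem_chart_source E z₀)
  filter_upwards [hes.eventually hsmall, hes.eventually (Metric.ball_mem_nhds _ hR),
    e.open_source.mem_nhds (mem_chart_source E z₀)] with z hz1 hz2 hz3
  have := (hlip _ hz2).trans_lt hz1
  rw [e.left_inv hz3, Complex.dist_eq] at this
  have h3 : |((f z : Multiset S).count y : ℤ) - ((f z₀ : Multiset S).count y : ℤ)| < 1 := by
    have h4 : ‖(((((f z : Multiset S).count y : ℤ) - ((f z₀ : Multiset S).count y : ℤ) : ℤ)) : ℂ)‖
        < 1 := by simpa using this
    rw [Complex.norm_intCast] at h4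
    exact_mod_cast h4
  have := Int.abs_lt_one_iff.1 h3
  omega

/-! ### Gluing charts -/

theorem OpenPartialHomeomorph.disjointUnion_apply_left {X Y : Type*} [TopologicalSpace X]
    [TopologicalSpace Y] {e e' : OpenPartialHomeomorph X Y} [∀ x, Decidable (x ∈ e.source)]
    [∀ y, Decidable (y ∈ e.target)] (hs : Disjoint e.source e'.source)
    (ht : Disjoint e.target e'.target) {x : X} (hx : x ∈ e.source) :
    e.disjointUnion e' hs ht x = e x :=
  Set.piecewise_eq_of_mem _ _ _ hx

theorem OpenPartialHomeomorph.disjointUnion_apply_right {X Y : Type*} [TopologicalSpace X]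
    [TopologicalSpace Y] {e e' : OpenPartialHomeomorph X Y} [∀ x, Decidable (x ∈ e.source)]
    [∀ y, Decidable (y ∈ e.target)] (hs : Disjoint e.source e'.source)
    (ht : Disjoint e.target e'.target) {x : X} (hx : x ∈ e'.source) :
    e.disjointUnion e' hs ht x = e' x :=
  Set.piecewise_eq_of_notMem _ _ _ (hs.notMem_of_mem_right hx)

theorem IsManifold.disjointUnion_mem_maximalAtlas {S : Type*} [TopologicalSpace S]
    [ChartedSpace ℂ S] [IsManifold 𝓘(ℂ) 1 S] {e e' : OpenPartialHomeomorph S ℂ}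
    [∀ x, Decidable (x ∈ e.source)] [∀ y, Decidable (y ∈ e.target)]
    (he : e ∈ IsManifold.maximalAtlas 𝓘(ℂ) 1 S) (he' : e' ∈ IsManifold.maximalAtlas 𝓘(ℂ) 1 S)
    (hs : Disjoint e.source e'.source) (ht : Disjoint e.target e'.target) :
    e.disjointUnion e' hs ht ∈ IsManifold.maximalAtlas 𝓘(ℂ) 1 S := by
  rw [IsManifold.mem_maximalAtlas_iff_contMDiffOn] at he he' ⊢
  exact ⟨ContMDiffOn.union_of_isOpen
      (he.1.congr fun x hx => Set.piecewise_eq_of_mem _ _ _ hx)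
      (he'.1.congr fun x hx => Set.piecewise_eq_of_notMem _ _ _ (hs.notMem_of_mem_right hx))
      e.open_source e'.open_source,
    ContMDiffOn.union_of_isOpen
      (he.2.congr fun x hx => Set.piecewise_eq_of_mem _ _ _ hx)
      (he'.2.congr fun x hx => Set.piecewise_eq_of_notMem _ _ _ (ht.notMem_of_mem_right hx))
      e.open_target e'.open_target⟩

/-- There is a holomorphic chart at `x` with prescribed value at `x`. -/
theorem IsManifold.exists_mem_maximalAtlas_apply_eq {S : Type*} [TopologicalSpace S]
    [ChartedSpace ℂ S] [IsManifold 𝓘(ℂ) 1 S] (x : S) (q : ℂ) :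
    ∃ χ ∈ IsManifold.maximalAtlas 𝓘(ℂ) 1 S, x ∈ χ.source ∧ χ x = q := by
  have h := (IsManifold.mem_maximalAtlas_iff_contMDiffOn _).1
    (IsManifold.chart_mem_maximalAtlas (I := 𝓘(ℂ)) (n := 1) x)
  refine ⟨(chartAt ℂ x).transHomeomorph (Homeomorph.addRight (q - chartAt ℂ x x)),
    (IsManifold.mem_maximalAtlas_iff_contMDiffOn _).2 ⟨?_, ?_⟩, by simp, by simp⟩
  · have ha : ContMDiff 𝓘(ℂ) 𝓘(ℂ) 1 fun w : ℂ => w + (q - chartAt ℂ x x) :=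
      ContDiff.contMDiff (by fun_prop)
    exact ha.comp_contMDiffOn h.1
  · have ha : ContMDiff 𝓘(ℂ) 𝓘(ℂ) 1 fun w : ℂ => w + -(q - chartAt ℂ x x) :=
      ContDiff.contMDiff (by fun_prop)
    exact h.2.comp ha.contMDiffOn fun w hw => by simpa using hw

/-- A chart whose values on `K` are less than `1` in absolute value, except at `y`, can be
modified away from `y` so that its domain contains a given finite set. -/
theorem IsManifold.exists_mem_maximalAtlas_finset_subset {S : Type*} [TopologicalSpace S]
    [T2Space S] [ChartedSpace ℂ S] [IsManifold 𝓘(ℂ) 1 S] {K : Set S} {y : S}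
    {ψ : OpenPartialHomeomorph S ℂ} (hψ : ψ ∈ IsManifold.maximalAtlas 𝓘(ℂ) 1 S)
    (hy : y ∈ ψ.source) (hψy : ψ y = 1) (hpeak : ∀ x ∈ ψ.source ∩ K, x ≠ y → ‖ψ x‖ < 1)
    (T : Finset S) :
    ∃ φ ∈ IsManifold.maximalAtlas 𝓘(ℂ) 1 S, y ∈ φ.source ∧ (T : Set S) ⊆ φ.source ∧ φ y = 1 ∧
      ∀ x ∈ φ.source ∩ K, x ≠ y → ‖φ x‖ < 1 := by
  classical
  induction T using Finset.induction_on with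
  | empty => exact ⟨ψ, hψ, hy, by simp, hψy, hpeak⟩
  | insert a T _ ih =>
    obtain ⟨φ, hφ, hyφ, hT, hφy, hp⟩ := ih
    by_cases haφ : a ∈ φ.source
    · exact ⟨φ, hφ, hyφ, by simp [Set.insert_subset_iff, haφ, hT], hφy, hp⟩
    -- `y` is added because it must also stay in the domain when `φ` is shrunk.
    set T' : Finset S := insert y T with hT'
    have hT'φ : (T' : Set S) ⊆ φ.source := by simp [hT', Set.insert_subset_iff, hyφ, hT]
    have haT' : a ∉ T' := fun h => haφ (hT'φ h)
    obtain ⟨V, W, hV, hW, haV, hTW, hVW⟩ :=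
      SeparatedNhds.of_singleton_finset haT'
    rw [Set.singleton_subset_iff] at haV
    -- This disk is reserved for the values of the chart at `a`. Lying in the unit disk, it
    -- preserves the peak condition; missing `φ(T')`, it can be removed from the image of `φ`
    -- without losing a point of `T'`.
    obtain ⟨q, ε, hε, hqε⟩ : ∃ q : ℂ, ∃ ε > 0,
        Metric.closedBall q ε ⊆ Metric.ball 0 1 ∩ ((T'.image φ : Finset ℂ) : Set ℂ)ᶜ := by
      have ho : IsOpen (Metric.ball (0 : ℂ) 1 ∩ ((T'.image φ : Finset ℂ) : Set ℂ)ᶜ) :=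
        Metric.isOpen_ball.inter (Finset.finite_toSet _).isClosed.isOpen_compl
      obtain ⟨q, hq⟩ : (Metric.ball (0 : ℂ) 1 ∩ ((T'.image φ : Finset ℂ) : Set ℂ)ᶜ).Nonempty := by
        have hinf : (Metric.ball (0 : ℂ) 1).Infinite :=
          infinite_of_mem_nhds 0 (Metric.ball_mem_nhds _ one_pos)
        obtain ⟨q, hq⟩ := (hinf.sdiff (Finset.finite_toSet (T'.image φ))).nonempty
        exact ⟨q, hq⟩
      obtain ⟨ε, hε, h⟩ := Metric.nhds_basis_closedBall.mem_iff.1 (ho.mem_nhds hq)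
      exact ⟨q, ε, hε, h⟩
    obtain ⟨χ, hχ, haχ, hχa⟩ := IsManifold.exists_mem_maximalAtlas_apply_eq a q
    have hO1 : IsOpen (W ∩ (φ.source ∩ φ ⁻¹' (Metric.closedBall q ε)ᶜ)) :=
      hW.inter (φ.isOpen_inter_preimage Metric.isClosed_closedBall.isOpen_compl)
    have hO2 : IsOpen (V ∩ (χ.source ∩ χ ⁻¹' Metric.ball q ε)) :=
      hV.inter (χ.isOpen_inter_preimage Metric.isOpen_ball)
    set φ' := φ.restr (W ∩ (φ.source ∩ φ ⁻¹' (Metric.closedBall q ε)ᶜ)) with hφ'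
    set χ' := χ.restr (V ∩ (χ.source ∩ χ ⁻¹' Metric.ball q ε)) with hχ'
    have hφ'm : φ' ∈ IsManifold.maximalAtlas 𝓘(ℂ) 1 S :=
      restr_mem_maximalAtlas (contDiffGroupoid 1 𝓘(ℂ)) hφ hO1
    have hχ'm : χ' ∈ IsManifold.maximalAtlas 𝓘(ℂ) 1 S :=
      restr_mem_maximalAtlas (contDiffGroupoid 1 𝓘(ℂ)) hχ hO2
    have hs1 : ∀ x, x ∈ φ'.source ↔ x ∈ W ∧ x ∈ φ.source ∧ φ x ∉ Metric.closedBall q ε := by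
      intro x
      rw [hφ', OpenPartialHomeomorph.restr_source' _ _ hO1]
      exact ⟨fun h => h.2, fun h => ⟨h.2.1, h⟩⟩
    have hs2 : ∀ x, x ∈ χ'.source ↔ x ∈ V ∧ x ∈ χ.source ∧ χ x ∈ Metric.ball q ε := by
      intro x
      rw [hχ', OpenPartialHomeomorph.restr_source' _ _ hO2]
      exact ⟨fun h => h.2, fun h => ⟨h.2.1, h⟩⟩
    have hds : Disjoint φ'.source χ'.source := Set.disjoint_left.2 fun x h1 h2 =>
      Set.disjoint_left.1 hVW ((hs2 x).1 h2).1 ((hs1 x).1 h1).1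
    have hdt : Disjoint φ'.target χ'.target := by
      rw [← φ'.image_source_eq_target, ← χ'.image_source_eq_target, Set.disjoint_left]
      rintro _ ⟨x, hx, rfl⟩ ⟨x', hx', h⟩
      have h1 : φ x ∉ Metric.closedBall q ε := ((hs1 x).1 hx).2.2
      have h2 : χ x' ∈ Metric.ball q ε := ((hs2 x').1 hx').2.2
      have h3 : χ x' = φ x := h
      exact h1 (h3 ▸ Metric.ball_subset_closedBall h2)
    have hval1 : ∀ x ∈ φ'.source, φ'.disjointUnion χ' hds hdt x = φ x := fun x hx =>
      OpenPartialHomeomorph.disjointUnion_apply_left hds hdt hx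
    have hval2 : ∀ x ∈ χ'.source, φ'.disjointUnion χ' hds hdt x = χ x := fun x hx =>
      OpenPartialHomeomorph.disjointUnion_apply_right hds hdt hx
    have hT'' : ∀ x ∈ T', x ∈ φ'.source := fun x hx => (hs1 x).2
      ⟨hTW hx, hT'φ hx, fun h => (hqε h).2 (by simpa using ⟨x, hx, rfl⟩)⟩
    have hyT : y ∈ φ'.source := hT'' y (by simp [hT'])
    refine ⟨φ'.disjointUnion χ' hds hdt,
      IsManifold.disjointUnion_mem_maximalAtlas hφ'm hχ'm hds hdt, Or.inl hyT, ?_,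
      (hval1 y hyT).trans hφy, ?_⟩
    · intro x hx
      rw [Finset.coe_insert, Set.mem_insert_iff] at hx
      rcases hx with rfl | hx
      · exact Or.inr ((hs2 x).2 ⟨haV, haχ, by simpa [hχa] using hε⟩)
      · exact Or.inl (hT'' x (by simp [hT', Finset.mem_coe.1 hx]))
    · rintro x ⟨hx | hx, hxK⟩ hxy
      · rw [hval1 x hx]
        exact hp x ⟨((hs1 x).1 hx).2.1, hxK⟩ hxy
      · rw [hval2 x hx]
        simpa using (hqε (Metric.ball_subset_closedBall ((hs2 x).1 hx).2.2)).1

/-! ### Peaking charts at boundary points -/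

/-- The derivative is Lipschitz near `p`, so the mean value inequality on the ball of radius `‖w -
p‖` gives a quadratic error. This is where `C²` smoothness enters. -/
theorem ContDiffAt.exists_norm_sub_sub_fderiv_le {E F : Type*} [NormedAddCommGroup E]
    [NormedSpace ℝ E] [NormedAddCommGroup F] [NormedSpace ℝ F] {ρ : E → F} {p : E}
    (h : ContDiffAt ℝ 2 ρ p) :
    ∃ C : ℝ, 0 ≤ C ∧ ∀ᶠ w in 𝓝 p, ‖ρ w - ρ p - fderiv ℝ ρ p (w - p)‖ ≤ C * ‖w - p‖ ^ 2 := by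
  have h1 : ContDiffAt ℝ 1 (fderiv ℝ ρ) p := h.fderiv_right (by norm_num)
  obtain ⟨K, t, ht, hK⟩ := h1.exists_lipschitzOnWith
  have hd : ∀ᶠ w in 𝓝 p, DifferentiableAt ℝ ρ w := by
    filter_upwards [h.eventually (by simp)] with w hw using hw.differentiableAt (by simp)
  obtain ⟨r, hr, hball⟩ := Metric.eventually_nhds_iff_ball.1 (hd.and ht)
  refine ⟨K, K.2, Metric.eventually_nhds_iff_ball.2 ⟨r, hr, fun w hw => ?_⟩⟩
  have hsub : Metric.closedBall p ‖w - p‖ ⊆ Metric.ball p r := by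
    refine Metric.closedBall_subset_ball ?_
    rwa [← dist_eq_norm]
  have := (convex_closedBall p ‖w - p‖).norm_image_sub_le_of_norm_fderiv_le' (𝕜 := ℝ) (f := ρ)
    (φ := fderiv ℝ ρ p) (C := K * ‖w - p‖) (x := p) (y := w)
    (fun x hx => (hball x (hsub hx)).1) (fun x hx => ?_) (by simp) (by simp [dist_eq_norm])
  · rwa [sq, ← mul_assoc]
  · refine (hK.norm_sub_le (hball x (hsub hx)).2 (mem_of_mem_nhds ht)).trans ?_
    rw [Metric.mem_closedBall, dist_eq_norm] at hx
    gcongr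

theorem Complex.exists_re_mul_eq_of_continuousLinearMap (L : ℂ →L[ℝ] ℝ) :
    ∃ a : ℂ, ∀ h, L h = (a * h).re := by
  refine ⟨⟨L 1, -L Complex.I⟩, fun h => ?_⟩
  have h1 : h = h.re • (1 : ℂ) + h.im • Complex.I := by simp [Complex.re_add_im]
  conv_lhs => rw [h1, map_add, map_smul, map_smul]
  simp
  ring

/-- The Möbius transformation `w ↦ 1 / (1 + b (w - p))`. -/
noncomputable def Complex.invAffinePartialHomeomorph (p : ℂ) {b : ℂ} (hb : b ≠ 0) :
    OpenPartialHomeomorph ℂ ℂ where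
  toFun w := (1 + b * (w - p))⁻¹
  invFun v := p + b⁻¹ * (v⁻¹ - 1)
  source := {w | 1 + b * (w - p) ≠ 0}
  target := {v | v ≠ 0}
  map_source' w hw := inv_ne_zero hw
  map_target' v hv := by simpa [hb] using hv
  left_inv' w hw := by simp [hb]
  right_inv' v hv := by simp [hb]
  open_source := isOpen_ne_fun (by fun_prop) continuous_const
  open_target := isOpen_ne
  continuousOn_toFun := ContinuousOn.inv₀ (by fun_prop) fun w hw => hw
  continuousOn_invFun := by
    have : ContinuousOn (fun v : ℂ => v⁻¹) {v | v ≠ 0} := continuousOn_inv₀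
    fun_prop

theorem IsManifold.trans_invAffine_mem_maximalAtlas {S : Type*} [TopologicalSpace S]
    [ChartedSpace ℂ S] [IsManifold 𝓘(ℂ) 1 S] {e : OpenPartialHomeomorph S ℂ}
    (he : e ∈ IsManifold.maximalAtlas 𝓘(ℂ) 1 S) (p : ℂ) {b : ℂ} (hb : b ≠ 0) :
    e.trans (Complex.invAffinePartialHomeomorph p hb) ∈ IsManifold.maximalAtlas 𝓘(ℂ) 1 S := by
  rw [IsManifold.mem_maximalAtlas_iff_contMDiffOn] at he ⊢
  constructor
  · have h1 : ContMDiffOn 𝓘(ℂ) 𝓘(ℂ) 1 (fun w => (1 + b * (w - p))⁻¹)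
        {w | 1 + b * (w - p) ≠ 0} :=
      ContDiffOn.contMDiffOn (ContDiffOn.inv (by fun_prop) fun w hw => hw)
    exact h1.comp (he.1.mono fun x hx => (by simpa using hx.1)) fun x hx => hx.2
  · have h1 : ContMDiffOn 𝓘(ℂ) 𝓘(ℂ) 1 (fun v => p + b⁻¹ * (v⁻¹ - 1)) {v : ℂ | v ≠ 0} := by
      have : ContDiffOn ℂ 1 (fun v : ℂ => v⁻¹) {v | v ≠ 0} := contDiffOn_id.inv fun w hw => hw
      exact ContDiffOn.contMDiffOn (by fun_prop)
    exact he.2.comp (h1.mono fun x hx => hx.1) fun x hx => hx.2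

/-- An exterior tangent disk, in the form of an inequality: `1 / (1 + b (w - p))` peaks at `p`
among the points where `ρ ≥ 0`. -/
theorem ContDiffAt.exists_one_lt_norm_one_add_mul {ρ : ℂ → ℝ} {p : ℂ} (h : ContDiffAt ℝ 2 ρ p)
    (h' : fderiv ℝ ρ p ≠ 0) (hp : ρ p ≤ 0) :
    ∃ b : ℂ, b ≠ 0 ∧ ∀ᶠ w in 𝓝 p, 0 ≤ ρ w → w ≠ p → 1 < ‖1 + b * (w - p)‖ := by
  obtain ⟨C, hC, hev⟩ := h.exists_norm_sub_sub_fderiv_le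
  obtain ⟨a, ha⟩ := Complex.exists_re_mul_eq_of_continuousLinearMap (fderiv ℝ ρ p)
  have ha0 : a ≠ 0 := by
    rintro rfl
    exact h' (ContinuousLinearMap.ext fun v => by simp [ha])
  have han : 0 < ‖a‖ ^ 2 := by positivity
  -- With `b = t * a` and `u = w - p`, the Taylor bound gives `‖1 + b * u‖ ^ 2 ≥ 1 - 2 * t * C * ‖u‖
  -- ^ 2 + t ^ 2 * ‖a‖ ^ 2 * ‖u‖ ^ 2`. This `t` makes the right side `1 + t * ‖u‖ ^ 2`.
  set t : ℝ := (2 * C + 1) / ‖a‖ ^ 2 with ht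
  have ht0 : 0 < t := by positivity
  have hta : t * ‖a‖ ^ 2 = 2 * C + 1 := by rw [ht]; field_simp
  refine ⟨t * a, mul_ne_zero (by exact_mod_cast ht0.ne') ha0, hev.mono fun w hw hρ hwp => ?_⟩
  set u := w - p with hu
  have hu0 : 0 < ‖u‖ ^ 2 := by have := sub_ne_zero.2 hwp; positivity
  have hre : -(C * ‖u‖ ^ 2) ≤ (a * u).re := by
    have := (abs_le.1 (Real.norm_eq_abs _ ▸ hw)).2
    rw [ha] at this
    linarith
  have hsq : ‖1 + t * a * u‖ ^ 2 = 1 + 2 * t * (a * u).re + t ^ 2 * ‖a‖ ^ 2 * ‖u‖ ^ 2 := by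
    have : ‖a * u‖ ^ 2 = ‖a‖ ^ 2 * ‖u‖ ^ 2 := by rw [norm_mul, mul_pow]
    rw [mul_assoc, mul_assoc (t ^ 2), ← this, Complex.sq_norm, Complex.sq_norm,
      Complex.normSq_apply, Complex.normSq_apply]
    simp only [Complex.add_re, Complex.add_im, Complex.one_re, Complex.one_im,
      Complex.re_ofReal_mul, Complex.im_ofReal_mul]
    ring
  refine (one_lt_sq_iff₀ (norm_nonneg _)).1 ?_
  rw [hsq]
  have h1 : 2 * t * -(C * ‖u‖ ^ 2) ≤ 2 * t * (a * u).re := by gcongr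
  have h2 : t ^ 2 * ‖a‖ ^ 2 * ‖u‖ ^ 2 = t * (2 * C + 1) * ‖u‖ ^ 2 := by rw [← hta]; ring
  have h3 : 0 < t * ‖u‖ ^ 2 := mul_pos ht0 hu0
  rw [h2]
  linarith

/-- If `ρ` were negative at such a point, it would be negative at nearby points outside `D`, against
the sublevel description. Passing to the closure matters because entries of `f z` may lie on the
boundary. -/
theorem IsC2ClosedDisk.eventually_nonneg {S : Type*} [TopologicalSpace S] [ChartedSpace ℂ S]
    {D : Set S} {p : S} {ρ : ℂ → ℝ} (hρ : ContDiffAt ℝ 2 ρ (chartAt ℂ p p))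
    (h : ∀ᶠ x in 𝓝 p, (x ∈ D ↔ ρ (chartAt ℂ p x) ≤ 0)) :
    ∀ᶠ x in 𝓝 p, x ∈ closure Dᶜ → 0 ≤ ρ (chartAt ℂ p x) := by
  have hp := mem_chart_source ℂ p
  have hc : ∀ᶠ w in 𝓝 (chartAt ℂ p p), ContinuousAt ρ w := by
    filter_upwards [hρ.eventually (by simp)] with w hw using hw.continuousAt
  filter_upwards [h.eventually_nhds, ((chartAt ℂ p).continuousAt hp).eventually hc,
    (chartAt ℂ p).open_source.mem_nhds hp] with x h1 h2 h3 hx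
  by_contra! hneg
  have h4 : ContinuousAt (fun y => ρ (chartAt ℂ p y)) x :=
    ContinuousAt.comp (g := ρ) h2 ((chartAt ℂ p).continuousAt h3)
  obtain ⟨y, hyD, hy1, hy2⟩ :=
    ((mem_closure_iff_frequently.1 hx).and_eventually
      (h1.and (h4.eventually_lt continuousAt_const hneg))).exists
  exact hyD (hy1.2 hy2.le)

/-- At each boundary point `y` of a bordered Riemann surface `Y` there is a holomorphic chart
which peaks at `y` on the closure of `Y`. -/
theorem IsC2Bordered.exists_peak_chart {S : Type*} [TopologicalSpace S] [ChartedSpace ℂ S]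
    [IsManifold 𝓘(ℂ) 1 S] {Y : Set S} (hY : IsC2Bordered Y) {y : S} (hy : y ∈ frontier Y) :
    ∃ ψ ∈ IsManifold.maximalAtlas 𝓘(ℂ) 1 S, y ∈ ψ.source ∧ ψ y = 1 ∧
      ∀ x ∈ ψ.source ∩ closure Y, x ≠ y → ‖ψ x‖ < 1 := by
  obtain ⟨-, m, D, -, hD, -, rfl⟩ := hY
  have hcl : IsClosed (⋃ j, D j) := isClosed_iUnion_of_finite fun j => (hD j).isClosed
  rw [frontier_compl, hcl.frontier_eq] at hy
  obtain ⟨j, hj⟩ := Set.mem_iUnion.1 hy.1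
  have hyj : y ∈ frontier (D j) := by
    rw [(hD j).isClosed.frontier_eq]
    exact ⟨hj, fun h => hy.2 (interior_mono (Set.subset_iUnion D j) h)⟩
  obtain ⟨ρ, hρ, hρ', hDρ⟩ := (hD j).smooth y hyj
  obtain ⟨b, hb, hpk⟩ := hρ.exists_one_lt_norm_one_add_mul hρ' (hDρ.self_of_nhds.1 hj)
  have hys := mem_chart_source ℂ y
  obtain ⟨U, hU, hUo, hyU⟩ := eventually_nhds_iff.1
    ((IsC2ClosedDisk.eventually_nonneg hρ hDρ).and
      (((chartAt ℂ y).continuousAt hys).eventually hpk))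
  refine ⟨((chartAt ℂ y).trans (Complex.invAffinePartialHomeomorph (chartAt ℂ y y) hb)).restr U,
    restr_mem_maximalAtlas (contDiffGroupoid 1 𝓘(ℂ)) (IsManifold.trans_invAffine_mem_maximalAtlas
      (IsManifold.chart_mem_maximalAtlas y) _ hb) hUo, ?_, ?_, ?_⟩
  · rw [OpenPartialHomeomorph.restr_source' _ _ hUo]
    simp [Complex.invAffinePartialHomeomorph, hyU]
  · simp [Complex.invAffinePartialHomeomorph]
  · rintro x ⟨hx, hxY⟩ hxy
    rw [OpenPartialHomeomorph.restr_source' _ _ hUo] at hx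
    have hxU : x ∈ U := hx.2
    have hxs : x ∈ (chartAt ℂ y).source := hx.1.1
    have h1 := (hU x hxU).1 (closure_mono (Set.compl_subset_compl.2 (Set.subset_iUnion D j)) hxY)
    have h2 := (hU x hxU).2 h1 fun h => hxy ((chartAt ℂ y).injOn hxs hys h)
    change ‖(1 + b * (chartAt ℂ y x - chartAt ℂ y y))⁻¹‖ < 1
    rw [norm_inv]
    exact inv_lt_one_of_one_lt₀ h2

/-! ### From local to global -/

theorem propositionp
    {S : Type*} [TopologicalSpace S] [T2Space S] [CompactSpace S] [ConnectedSpace S]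
    [ChartedSpace ℂ S] [IsManifold 𝓘(ℂ) 1 S] [DecidableEq S]
    {Y : Set S} (hY : IsC2Bordered Y)
    {E : Type*} [NormedAddCommGroup E] [NormedSpace ℂ E] [FiniteDimensional ℂ E]
    {Z : Type*} [TopologicalSpace Z] [ConnectedSpace Z]
    [ChartedSpace E Z] [IsManifold 𝓘(ℂ, E) 1 Z]
    {n : ℕ} (hn : 1 ≤ n)
    (f : Z → Sym S n) (hf : SymProd.IsHolomorphic (E := E) f)
    (hfY : ∀ z, f z ∈ closure (SymProd.symSet n Y))
    (z₀ : Z) (y₁ : S) (hy₁ : y₁ ∈ frontier Y) (hz₀ : y₁ ∈ f z₀) :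
    (∀ z, y₁ ∈ f z) ∧
      ∀ k : ℕ, 1 ≤ k → k ≤ n → Multiset.count y₁ (f z₀ : Multiset S) = k →
        ∀ z, Multiset.count y₁ (f z : Multiset S) = k := by
  obtain ⟨ψ, hψ, hyψ, hψy, hpeak⟩ := hY.exists_peak_chart hy₁
  -- Multiplicity zero is included: the chart peaks at `y₁` whether or not `y₁` is an entry of `f
  -- z`.
  have hloc : IsLocallyConstant fun z => (f z : Multiset S).count y₁ := by
    refine (IsLocallyConstant.iff_eventually_eq _).2 fun z => ?_
    obtain ⟨φ, hφ, -, hT, hφy, hφpeak⟩ :=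
      IsManifold.exists_mem_maximalAtlas_finset_subset hψ hyψ hψy hpeak (f z : Multiset S).toFinset
    exact hf.eventually_count_eq (fun z => SymProd.closure_symSet_subset Y (hfY z)) hφ hφy hφpeak
      fun x hx => hT (by simpa using hx)
  have hconst : ∀ z, (f z : Multiset S).count y₁ = (f z₀ : Multiset S).count y₁ := fun z =>
    hloc.apply_eq_of_preconnectedSpace z z₀
  refine ⟨fun z => ?_, fun k _ _ hk z => (hconst z).trans hk⟩
  rw [← Sym.mem_coe, ← Multiset.count_pos, hconst z, Multiset.count_pos]
  exact hz₀
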